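/- For $d\ge 0$ let $\mathcal P_d\subset\mathbb R^d$ be the pellytope, i.e. the Newton polytope of the polynomial $\prod_{i=1}^d(1+y_i)\prod_{j=1}^{d-1}(1+y_j+y_jy_{j+1})$, and let $\Sigma_d$ be its inner normal fan: the set of the cones $\{w\in\mathbb R^d \mid \langle w,x\rangle\le\langle w,y\rangle \text{ for all } x\in F,\ y\in\mathcal P_d\}$, where $F$ runs over the non-empty faces of $\mathcal P_d$ (so $\Sigma_0=\{\{0\}\}$). For a fan $\Sigma$ in $\mathbb R^d$ and $\tau\in\Sigma$ with linear span $L(\tau)$, let $\mathrm{Star}_\Sigma(\tau)=\{\pi(\sigma)\mid \tau\subseteq\sigma\in\Sigma\}$, where $\pi\colon\mathbb R^d\to\mathbb R^d/L(\tau)$ is the projection. The product of fans is $\Sigma\times\Sigma'=\{C\times C'\mid C\in\Sigma,\ C'\in\Sigma'\}$. Write $\rho_v=\mathbb R_{\ge0}v$, and let $e_1,\dots,e_d$ be the standard basis of $\mathbb R^d$. **Lemma.** Let $d\ge1$. The rays (one-dimensional cones) of $\Sigma_d$ are exactly the $\rho_v$ with $v\in\{\pm e_1,\dots,\pm e_d,\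 e_1-e_2,\dots,e_{d-1}-e_d\}$, and $$\mathrm{Star}_{\Sigma_d}(\rho_v)=\begin{cases}\Sigma_{d-1}& v\in\{\pm e_1,\pm e_d\},\\ \Sigma_{i-1}\times\Sigma_{d-i}& v=\pm e_i,\ 1<i<d,\\ \Sigma_{d-2}\times\Sigma_1& v\in\{e_1-e_2,\ e_{d-1}-e_d\}\ (d\ge2),\\ \Sigma_{i-1}\times\Sigma_1\times\Sigma_{d-i-1}& v=e_i-e_{i+1},\ 2\le i\le d-2.\end{cases}$$ Here equality means that the fans correspond under the linear isomorphism from $\mathbb R^d/L(\rho_v)$ to $\mathbb R^{d-1}$ (written as the corresponding product of coordinate spaces) that is induced by the following map on $\mathbb R^d$: for $v=\pm e_i$ with $1\le i\le d$, $x\mapsto(x_1,\dots,x_{i-1},x_{i+1},\dots,x_d)$, split after the first $i-1$ coordinates when $1<i<d$; for $v=e_1-e_2$, $x\mapsto((x_3,\dots,x_d),\,x_1+x_2)$; for $v=e_{d-1}-e_d$, $x\mapsto((x_1,\dots,x_{d-2}),\,x_{d-1}+x_d)$; for $v=e_i-e_{i+1}$ with $2\le i\le d-2$, $x\mapsto((x_1,\dots,x_{i-1}),\,x_i+x_{i+1},\,(x_{i+2},\dots,x_d))$.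 -/

import Mathlib

/-- The Newton polytope of a polynomial: the convex hull of its exponent vectors. -/
def newtonPolytope {ι R : Type*} [CommSemiring R] (f : MvPolynomial ι R) : Set (ι → ℝ) :=
  convexHull ℝ ((fun (m : ι →₀ ℕ) (i : ι) => (m i : ℝ)) '' (f.support : Set (ι →₀ ℕ)))

/-- The polynomial `∏_{i=1}^d (1 + y_i) * ∏_{j=1}^{d-1} (1 + y_j + y_j y_{j+1})`; the variables
`y_1, …, y_d` are indexed by `0, …, d - 1`. -/
noncomputable def pellPolynomial (d : ℕ) : MvPolynomial (Fin d) ℤ :=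
  (∏ i : Fin d, (1 + MvPolynomial.X i)) *
    ∏ j : Fin (d - 1),
      (1 + MvPolynomial.X (⟨j.val, by omega⟩ : Fin d) +
        MvPolynomial.X (⟨j.val, by omega⟩ : Fin d) *
          MvPolynomial.X (⟨j.val + 1, by omega⟩ : Fin d))

/-- The pellytope `P_d` in `ℝ^d` (a point for `d = 0`). -/
noncomputable def pellytope (d : ℕ) : Set (Fin d → ℝ) :=
  newtonPolytope (pellPolynomial d)

/-- The face of `P` on which the linear functional `⟨u, ·⟩` is minimal. For a polytope `P`, these
are exactly the non-empty faces of `P`. -/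
def minFace {n : ℕ} (P : Set (Fin n → ℝ)) (u : Fin n → ℝ) : Set (Fin n → ℝ) :=
  {x | x ∈ P ∧ ∀ y ∈ P, u ⬝ᵥ x ≤ u ⬝ᵥ y}

/-- The inner normal cone of `P` along `F`: all `w` such that `⟨w, ·⟩` attains its minimum over `P`
at every point of `F`. -/
def innerNormalCone {n : ℕ} (P F : Set (Fin n → ℝ)) : PointedCone ℝ (Fin n → ℝ) where
  carrier := {w | ∀ x ∈ F, ∀ y ∈ P, w ⬝ᵥ x ≤ w ⬝ᵥ y}
  add_mem' := by
    intro a b ha hb x hx y hy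
    rw [add_dotProduct, add_dotProduct]
    exact add_le_add (ha x hx y hy) (hb x hx y hy)
  zero_mem' := by
    intro x _ y _
    rw [zero_dotProduct, zero_dotProduct]
  smul_mem' := by
    intro c a ha x hx y hy
    change ((c : ℝ) • a) ⬝ᵥ x ≤ ((c : ℝ) • a) ⬝ᵥ y
    rw [smul_dotProduct, smul_dotProduct]
    exact mul_le_mul_of_nonneg_left (ha x hx y hy) c.2

/-- The inner normal fan of a polytope, as the set of the normal cones of its non-empty faces. -/
def innerNormalFan {n : ℕ} (P : Set (Fin n → ℝ)) : Set (PointedCone ℝ (Fin n → ℝ)) :=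
  {C | ∃ u : Fin n → ℝ, C = innerNormalCone P (minFace P u)}

/-- The pellytope fan `Σ_d`, the inner normal fan of the pellytope `P_d`. -/
noncomputable def pellFan (d : ℕ) : Set (PointedCone ℝ (Fin d → ℝ)) :=
  innerNormalFan (pellytope d)

/-- The cone generated by the single vector `v`. -/
def ray {V : Type*} [AddCommGroup V] [Module ℝ V] (v : V) : PointedCone ℝ V :=
  PointedCone.hull ℝ {v}

/-- The linear span `L(τ)` of a cone `τ`. -/
def linSpan {V : Type*} [AddCommGroup V] [Module ℝ V] (τ : PointedCone ℝ V) : Submodule ℝ V :=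
  Submodule.span ℝ (τ : Set V)

/-- The star of `τ` in a collection of cones: the images in `V / L(τ)` of the cones that
contain `τ`. -/
def fanStar {V : Type*} [AddCommGroup V] [Module ℝ V] (S : Set (PointedCone ℝ V))
    (τ : PointedCone ℝ V) : Set (PointedCone ℝ (V ⧸ linSpan τ)) :=
  {C | ∃ σ ∈ S, τ ≤ σ ∧ C = PointedCone.map (linSpan τ).mkQ σ}

/-- The product of two fans. -/
def fanProd {V W : Type*} [AddCommGroup V] [Module ℝ V] [AddCommGroup W] [Module ℝ W]
    (S : Set (PointedCone ℝ V)) (T : Set (PointedCone ℝ W)) : Set (PointedCone ℝ (V × W)) :=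
  {C | ∃ σ ∈ S, ∃ τ ∈ T, C = Submodule.prod σ τ}

/-- The linear isomorphism `φ` identifies the fan `S` with the fan `T`. -/
def IsFanIso {V W : Type*} [AddCommGroup V] [Module ℝ V] [AddCommGroup W] [Module ℝ W]
    (φ : V ≃ₗ[ℝ] W) (S : Set (PointedCone ℝ V)) (T : Set (PointedCone ℝ W)) : Prop :=
  PointedCone.map (φ : V →ₗ[ℝ] W) '' S = T

/-- The standard basis vector `e_i` of `ℝ^d` for `1 ≤ i ≤ d`, counted from `1`. -/
def stdVec (d i : ℕ) : Fin d → ℝ := fun k => if k.val + 1 = i then 1 else 0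

/-- The `3d - 1` vectors `e_1, …, e_d, -e_1, …, -e_d, e_1 - e_2, …, e_{d-1} - e_d`. -/
def pellGenerators (d : ℕ) : Set (Fin d → ℝ) :=
  {v | (∃ i, 1 ≤ i ∧ i ≤ d ∧ (v = stdVec d i ∨ v = -stdVec d i)) ∨
    (∃ i, 1 ≤ i ∧ i + 1 ≤ d ∧ v = stdVec d i - stdVec d (i + 1))}

/-- The rays (one-dimensional cones) of a fan. -/
def fanRays {V : Type*} [AddCommGroup V] [Module ℝ V] (S : Set (PointedCone ℝ V)) :
    Set (PointedCone ℝ V) :=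
  {ρ | ρ ∈ S ∧ Module.finrank ℝ (linSpan ρ) = 1}

/-!
The normal cone of a Minkowski sum at `u` is the intersection of the normal cones of the summands
at `u`, and the pellytope is a Minkowski sum of segments and triangles. Hence the cone of `Σ_d` with
`u` in its relative interior consists of the `w` whose coordinates `w_i`, together with the sums
`w_i + w_{i+1}` for which `u_i > 0 > u_{i+1}`, have weakly the sign that they have at `u`. If this
cone contains `v`, then in its image modulo `v` only the conditions on the forms vanishing at `v`
survive, since the others can be met by adding a large multiple of `v`. For `v = ±e_i` the surviving
forms fall into the blocks before and after the coordinate `i`; for `v = e_i - e_{i+1}` the form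
`x_i + x_{i+1}` survives as a third block, because then `u_i > 0 > u_{i+1}`.
-/

open scoped Pointwise

theorem ker_eq_span_singleton_of_finrank_eq_succ {K V W : Type*} [DivisionRing K]
    [AddCommGroup V] [Module K V] [FiniteDimensional K V] [AddCommGroup W] [Module K W]
    {f : V →ₗ[K] W} (hf : Function.Surjective f)
    (hrank : Module.finrank K V = Module.finrank K W + 1) {v : V} (hv : v ≠ 0) (hfv : f v = 0) :
    LinearMap.ker f = Submodule.span K {v} := by
  have hle : Submodule.span K {v} ≤ LinearMap.ker f := by simpa using hfv
  refine (Submodule.eq_of_le_of_finrank_eq hle ?_).symm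
  have hsum := f.finrank_range_add_finrank_ker
  rw [LinearMap.range_eq_top.2 hf, finrank_top] at hsum
  rw [finrank_span_singleton hv]
  omega

section Cones

variable {V W V' W' : Type*} [AddCommGroup V] [Module ℝ V] [AddCommGroup W] [Module ℝ W]
  [AddCommGroup V'] [Module ℝ V'] [AddCommGroup W'] [Module ℝ W']

theorem mem_ray {v x : V} : x ∈ ray v ↔ ∃ c : ℝ, 0 ≤ c ∧ c • v = x := by
  rw [ray, PointedCone.hull, Submodule.mem_span_singleton]
  exact ⟨fun ⟨c, hc⟩ => ⟨c, c.2, hc⟩, fun ⟨c, hc, h⟩ => ⟨⟨c, hc⟩, h⟩⟩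

theorem ray_le_iff {v : V} {σ : PointedCone ℝ V} : ray v ≤ σ ↔ v ∈ σ :=
  Submodule.span_singleton_le_iff_mem v σ

theorem linSpan_ray (v : V) : linSpan (ray v) = Submodule.span ℝ {v} :=
  Submodule.span_span_of_tower _ _ _

theorem eq_ray_of_finrank_linSpan_eq_one {σ : PointedCone ℝ V}
    (hσ : (σ : ConvexCone ℝ V).Salient) (hrank : Module.finrank ℝ (linSpan σ) = 1) {v : V}
    (hv : v ∈ σ) (hv0 : v ≠ 0) : σ = ray v := by
  refine le_antisymm (fun w hw => ?_) (ray_le_iff.2 hv)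
  have hspan : ∀ x ∈ σ, x ∈ linSpan σ := fun x hx => Submodule.subset_span hx
  obtain ⟨c, hc⟩ := exists_smul_eq_of_finrank_eq_one hrank
    (x := (⟨v, hspan v hv⟩ : linSpan σ)) (by simpa using hv0) ⟨w, hspan w hw⟩
  obtain rfl : c • v = w := congrArg Subtype.val hc
  refine mem_ray.2 ⟨c, not_lt.1 fun hc0 => ?_, rfl⟩
  refine hσ _ hw (smul_ne_zero hc0.ne hv0) ?_
  rw [← neg_smul]
  exact σ.smul_mem (neg_nonneg.2 hc0.le) hv

theorem IsFanIso.trans {φ : V ≃ₗ[ℝ] W} {ψ : W ≃ₗ[ℝ] V'} {S : Set (PointedCone ℝ V)}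
    {T : Set (PointedCone ℝ W)} {R : Set (PointedCone ℝ V')} (hφ : IsFanIso φ S T)
    (hψ : IsFanIso ψ T R) : IsFanIso (φ.trans ψ) S R := by
  rw [IsFanIso, ← hψ, ← hφ, Set.image_image]
  exact Set.image_congr fun σ _ => (PointedCone.map_map _ _ σ).symm

theorem IsFanIso.refl (S : Set (PointedCone ℝ V)) : IsFanIso (LinearEquiv.refl ℝ V) S S :=
  (Set.image_congr fun σ _ => PointedCone.map_id σ).trans (Set.image_id' S)

theorem fanProd_eq_image2 (S : Set (PointedCone ℝ V)) (T : Set (PointedCone ℝ W)) :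
    fanProd S T = Set.image2 (fun σ τ => Submodule.prod σ τ) S T := by
  simp only [fanProd, Set.image2, eq_comm]

theorem fanProd_range {ι κ : Type*} (c : ι → PointedCone ℝ V) (c' : κ → PointedCone ℝ W) :
    fanProd (Set.range c) (Set.range c') =
      Set.range fun p : ι × κ => Submodule.prod (c p.1) (c' p.2) := by
  rw [fanProd_eq_image2, Set.image2_range]

theorem IsFanIso.prodCongr {φ : V ≃ₗ[ℝ] V'} {ψ : W ≃ₗ[ℝ] W'} {S : Set (PointedCone ℝ V)}
    {S' : Set (PointedCone ℝ V')} {T : Set (PointedCone ℝ W)} {T' : Set (PointedCone ℝ W')}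
    (hφ : IsFanIso φ S S') (hψ : IsFanIso ψ T T') :
    IsFanIso (φ.prodCongr ψ) (fanProd S T) (fanProd S' T') := by
  rw [IsFanIso, ← hφ, ← hψ, fanProd_eq_image2, fanProd_eq_image2]
  exact Set.image_image2_distrib fun σ τ =>
    LinearMap.prodMap_map_prod (φ.toLinearMap.restrictScalars _) (ψ.toLinearMap.restrictScalars _)
      σ τ

theorem isFanIso_prodComm (S : Set (PointedCone ℝ V)) (T : Set (PointedCone ℝ W)) :
    IsFanIso (LinearEquiv.prodComm ℝ V W) (fanProd S T) (fanProd T S) := by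
  rw [IsFanIso, fanProd_eq_image2, fanProd_eq_image2, Set.image2_swap _ T, Set.image_image2]
  refine Set.image2_congr' fun σ τ => ?_
  ext ⟨y, x⟩
  simp [Submodule.mem_prod, and_comm]

theorem isFanIso_uniqueProd [Unique V] {S : Set (PointedCone ℝ V)} (hS : S.Nonempty)
    (T : Set (PointedCone ℝ W)) :
    IsFanIso (LinearEquiv.uniqueProd : (V × W) ≃ₗ[ℝ] W) (fanProd S T) T := by
  rw [IsFanIso, fanProd_eq_image2, Set.image_image2]
  refine Eq.trans (Set.image2_congr' fun σ τ => ?_) (Set.image2_right hS)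
  exact Submodule.prod_map_snd σ τ

theorem isFanIso_prodUnique [Unique W] (S : Set (PointedCone ℝ V)) {T : Set (PointedCone ℝ W)}
    (hT : T.Nonempty) :
    IsFanIso (LinearEquiv.prodUnique : (V × W) ≃ₗ[ℝ] V) (fanProd S T) S :=
  (isFanIso_prodComm S T).trans (isFanIso_uniqueProd hT S)

/-- `T` is the star of the ray of `v` in `S`, in the coordinates on the quotient by `ℝ v` that are
given by `f`. -/
def IsStarVia (S : Set (PointedCone ℝ V)) (v : V) (f : V → W) (T : Set (PointedCone ℝ W)) : Prop :=
  ∃ φ : (V ⧸ linSpan (ray v)) ≃ₗ[ℝ] W,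
    (∀ x : V, φ ((linSpan (ray v)).mkQ x) = f x) ∧ IsFanIso φ (fanStar S (ray v)) T

theorem IsStarVia.trans {S : Set (PointedCone ℝ V)} {v : V} {f : V → W}
    {T : Set (PointedCone ℝ W)} {R : Set (PointedCone ℝ V')} {e : W ≃ₗ[ℝ] V'}
    (h : IsStarVia S v f T) (he : IsFanIso e T R) : IsStarVia S v (fun x => e (f x)) R := by
  obtain ⟨φ, hφ, hS⟩ := h
  exact ⟨φ.trans e, fun x => congrArg e (hφ x), hS.trans he⟩

theorem IsStarVia.congr {S : Set (PointedCone ℝ V)} {v : V} {f g : V → W}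
    {T : Set (PointedCone ℝ W)} (h : IsStarVia S v f T) (hfg : ∀ x, f x = g x) :
    IsStarVia S v g T := funext hfg ▸ h

theorem isStarVia_of_surjective (S : Set (PointedCone ℝ V)) {v : V} {f : V →ₗ[ℝ] W}
    (hf : Function.Surjective f) (hker : LinearMap.ker f = Submodule.span ℝ {v}) :
    IsStarVia S v f (PointedCone.map f '' {σ ∈ S | v ∈ σ}) := by
  let φ : (V ⧸ linSpan (ray v)) ≃ₗ[ℝ] W :=
    (Submodule.quotEquivOfEq _ _ ((linSpan_ray v).trans hker.symm)).trans
      (f.quotKerEquivOfSurjective hf)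
  have map_mkQ (σ : PointedCone ℝ V) :
      PointedCone.map (φ : (V ⧸ linSpan (ray v)) →ₗ[ℝ] W)
        (PointedCone.map (linSpan (ray v)).mkQ σ) = PointedCone.map f σ :=
    PointedCone.map_map _ _ σ
  refine ⟨φ, fun x => rfl, Set.Subset.antisymm ?_ ?_⟩
  · rintro _ ⟨_, ⟨σ, hσ, hv, rfl⟩, rfl⟩
    exact ⟨σ, ⟨hσ, ray_le_iff.1 hv⟩, (map_mkQ σ).symm⟩
  · rintro _ ⟨σ, ⟨hσ, hv⟩, rfl⟩
    exact ⟨_, ⟨σ, hσ, ray_le_iff.2 hv, rfl⟩, map_mkQ σ⟩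

end Cones

section NormalFans

variable {n : ℕ}

/-- The cone of the inner normal fan of `P` with `u` in its relative interior: the inner normal
cone of the face of `P` selected by `u`. -/
def normalConeAt (P : Set (Fin n → ℝ)) (u : Fin n → ℝ) : PointedCone ℝ (Fin n → ℝ) :=
  innerNormalCone P (minFace P u)

theorem innerNormalFan_eq_range (P : Set (Fin n → ℝ)) :
    innerNormalFan P = Set.range (normalConeAt P) := by
  ext C
  simp only [innerNormalFan, normalConeAt, Set.mem_ofPred_eq, Set.mem_range, eq_comm]

theorem mem_innerNormalCone {P F : Set (Fin n → ℝ)} {w : Fin n → ℝ} :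
    w ∈ innerNormalCone P F ↔ ∀ x ∈ F, ∀ y ∈ P, w ⬝ᵥ x ≤ w ⬝ᵥ y := Iff.rfl

theorem minFace_nonempty {A : Set (Fin n → ℝ)} (hA : A.Finite) (hne : A.Nonempty)
    (u : Fin n → ℝ) : (minFace A u).Nonempty :=
  Set.exists_min_image A (u ⬝ᵥ ·) hA hne

theorem isLinearMap_dotProduct (u : Fin n → ℝ) : IsLinearMap ℝ (u ⬝ᵥ ·) :=
  ⟨dotProduct_add u, fun c x => dotProduct_smul c u x⟩

theorem le_dotProduct_convexHull_iff {A : Set (Fin n → ℝ)} {u : Fin n → ℝ} {c : ℝ} :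
    (∀ y ∈ convexHull ℝ A, c ≤ u ⬝ᵥ y) ↔ ∀ y ∈ A, c ≤ u ⬝ᵥ y :=
  (convex_halfSpace_ge (isLinearMap_dotProduct u) c).convexHull_subset_iff

theorem dotProduct_convexHull_le_iff {A : Set (Fin n → ℝ)} {u : Fin n → ℝ} {c : ℝ} :
    (∀ y ∈ convexHull ℝ A, u ⬝ᵥ y ≤ c) ↔ ∀ y ∈ A, u ⬝ᵥ y ≤ c :=
  (convex_halfSpace_le (isLinearMap_dotProduct u) c).convexHull_subset_iff

theorem convex_union_lt_dotProduct {C : Set (Fin n → ℝ)} (hC : Convex ℝ C) {u : Fin n → ℝ} {c : ℝ}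
    (hc : ∀ y ∈ C, c ≤ u ⬝ᵥ y) : Convex ℝ (C ∪ {y | c < u ⬝ᵥ y}) := by
  refine convex_iff_forall_pos.2 fun y hy z hz a b ha hb hab => ?_
  have hyz : a * (u ⬝ᵥ y - c) + b * (u ⬝ᵥ z - c) = u ⬝ᵥ (a • y + b • z) - c := by
    simp only [dotProduct_add, dotProduct_smul, smul_eq_mul]
    linear_combination -c * hab
  rcases hy with hy | hy <;> rcases hz with hz | hz
  · exact Or.inl (hC hy hz ha.le hb.le hab)
  all_goals refine Or.inr (sub_pos.1 (lt_of_lt_of_eq ?_ hyz))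
  · exact add_pos_of_nonneg_of_pos (mul_nonneg ha.le (sub_nonneg.2 (hc y hy)))
      (mul_pos hb (sub_pos.2 hz))
  · exact add_pos_of_pos_of_nonneg (mul_pos ha (sub_pos.2 hy))
      (mul_nonneg hb.le (sub_nonneg.2 (hc z hz)))
  · exact add_pos (mul_pos ha (sub_pos.2 hy)) (mul_pos hb (sub_pos.2 hz))

theorem minFace_convexHull (A : Set (Fin n → ℝ)) (u : Fin n → ℝ) :
    minFace (convexHull ℝ A) u = convexHull ℝ (minFace A u) := by
  ext x
  constructor
  · rintro ⟨hx, hmin⟩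
    have hle : ∀ y ∈ A, u ⬝ᵥ x ≤ u ⬝ᵥ y := le_dotProduct_convexHull_iff.1 hmin
    have hA : A ⊆ convexHull ℝ (minFace A u) ∪ {y | u ⬝ᵥ x < u ⬝ᵥ y} := fun y hy =>
      (hle y hy).eq_or_lt.imp_left fun hxy : u ⬝ᵥ x = u ⬝ᵥ y =>
        subset_convexHull ℝ _ ⟨hy, fun z hz => hxy ▸ hle z hz⟩
    have hconv := convex_union_lt_dotProduct (convex_convexHull ℝ (minFace A u))
      (le_dotProduct_convexHull_iff.2 fun y hy => hle y hy.1)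
    exact (convexHull_min hA hconv hx).resolve_right (lt_irrefl (u ⬝ᵥ x))
  · refine fun hx => ⟨convexHull_mono (Set.sep_subset _ _) hx, le_dotProduct_convexHull_iff.2 ?_⟩
    exact fun y hy => dotProduct_convexHull_le_iff.2 (fun z hz => hz.2 y hy) x hx

theorem innerNormalCone_convexHull (A F : Set (Fin n → ℝ)) :
    innerNormalCone (convexHull ℝ A) (convexHull ℝ F) = innerNormalCone A F := by
  ext w
  simp only [mem_innerNormalCone, le_dotProduct_convexHull_iff]
  exact ⟨fun h x hx => h x (subset_convexHull ℝ F hx),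
    fun h x hx y hy => dotProduct_convexHull_le_iff.2 (fun z hz => h z hz y hy) x hx⟩

theorem normalConeAt_convexHull (A : Set (Fin n → ℝ)) (u : Fin n → ℝ) :
    normalConeAt (convexHull ℝ A) u = normalConeAt A u := by
  rw [normalConeAt, minFace_convexHull, innerNormalCone_convexHull, normalConeAt]

theorem minFace_add (A B : Set (Fin n → ℝ)) (u : Fin n → ℝ) :
    minFace (A + B) u = minFace A u + minFace B u := by
  ext x
  constructor
  · rintro ⟨⟨a, ha, b, hb, rfl⟩, hmin⟩
    refine ⟨a, ⟨ha, fun y hy => ?_⟩, b, ⟨hb, fun y hy => ?_⟩, rfl⟩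
    · simpa [dotProduct_add] using hmin _ (Set.add_mem_add hy hb)
    · simpa [dotProduct_add] using hmin _ (Set.add_mem_add ha hy)
  · rintro ⟨a, ⟨ha, hamin⟩, b, ⟨hb, hbmin⟩, rfl⟩
    refine ⟨Set.add_mem_add ha hb, ?_⟩
    rintro _ ⟨y, hy, z, hz, rfl⟩
    simp only [dotProduct_add]
    exact add_le_add (hamin y hy) (hbmin z hz)

theorem innerNormalCone_add {A B F G : Set (Fin n → ℝ)} (hFA : F ⊆ A) (hGB : G ⊆ B)
    (hF : F.Nonempty) (hG : G.Nonempty) :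
    innerNormalCone (A + B) (F + G) = innerNormalCone A F ⊓ innerNormalCone B G := by
  ext w
  simp only [Submodule.mem_inf, mem_innerNormalCone]
  constructor
  · intro h
    obtain ⟨f₀, hf₀⟩ := hF
    obtain ⟨g₀, hg₀⟩ := hG
    refine ⟨fun x hx y hy => ?_, fun x hx y hy => ?_⟩
    · simpa [dotProduct_add] using
        h _ (Set.add_mem_add hx hg₀) _ (Set.add_mem_add hy (hGB hg₀))
    · simpa [dotProduct_add] using
        h _ (Set.add_mem_add hf₀ hx) _ (Set.add_mem_add (hFA hf₀) hy)
  · rintro ⟨hA, hB⟩ _ ⟨f, hf, g, hg, rfl⟩ _ ⟨y, hy, z, hz, rfl⟩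
    simp only [dotProduct_add]
    exact add_le_add (hA f hf y hy) (hB g hg z hz)

theorem normalConeAt_add {A B : Set (Fin n → ℝ)} {u : Fin n → ℝ} (hA : (minFace A u).Nonempty)
    (hB : (minFace B u).Nonempty) :
    normalConeAt (A + B) u = normalConeAt A u ⊓ normalConeAt B u := by
  rw [normalConeAt, minFace_add]
  exact innerNormalCone_add (Set.sep_subset _ _) (Set.sep_subset _ _) hA hB

theorem minFace_zero (u : Fin n → ℝ) : minFace 0 u = 0 := by
  ext x
  simp +contextual [minFace]

theorem normalConeAt_zero (u : Fin n → ℝ) : normalConeAt 0 u = ⊤ := by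
  ext w
  simp [normalConeAt, minFace_zero, mem_innerNormalCone]

theorem nonempty_minFace_sum {κ : Type*} {s : Finset κ} {A : κ → Set (Fin n → ℝ)} {u : Fin n → ℝ}
    (hA : ∀ k ∈ s, (minFace (A k) u).Nonempty) : (minFace (∑ k ∈ s, A k) u).Nonempty :=
  Finset.sum_induction A (fun B => (minFace B u).Nonempty)
    (fun B C hB hC => by rw [minFace_add]; exact hB.add hC) (by simp [minFace_zero]) hA

theorem normalConeAt_sum {κ : Type*} {s : Finset κ} {A : κ → Set (Fin n → ℝ)} {u : Fin n → ℝ}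
    (hA : ∀ k ∈ s, (minFace (A k) u).Nonempty) :
    normalConeAt (∑ k ∈ s, A k) u = ⨅ k ∈ s, normalConeAt (A k) u := by
  classical
  induction s using Finset.induction_on with
  | empty => simp [normalConeAt_zero]
  | insert k s hk ih =>
    rw [Finset.forall_mem_insert] at hA
    rw [Finset.sum_insert hk, normalConeAt_add hA.1 (nonempty_minFace_sum hA.2), ih hA.2,
      Finset.iInf_insert]

end NormalFans

section Exponents

variable {ι R : Type*} [CommSemiring R]

/-- The exponent vectors of a polynomial, as real vectors; the Newton polytope is their convex
hull. -/
def exponents (f : MvPolynomial ι R) : Set (ι → ℝ) :=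
  (fun (m : ι →₀ ℕ) (i : ι) => (m i : ℝ)) '' (f.support : Set (ι →₀ ℕ))

theorem exponents_map_of_injective {S : Type*} [CommSemiring S] (f : MvPolynomial ι R) {g : R →+* S}
    (hg : Function.Injective g) : exponents (MvPolynomial.map g f) = exponents f := by
  rw [exponents, exponents, MvPolynomial.support_map_of_injective _ hg]

theorem exponents_one [Nontrivial R] : exponents (1 : MvPolynomial ι R) = 0 := by
  rw [exponents, MvPolynomial.support_one, Finset.coe_singleton, Set.image_singleton]
  simp only [Finsupp.coe_zero, Pi.zero_apply, Nat.cast_zero]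
  rfl

theorem exponents_X [Nontrivial R] [DecidableEq ι] (i : ι) :
    exponents (MvPolynomial.X i : MvPolynomial ι R) = {Pi.single i 1} := by
  rw [exponents, MvPolynomial.support_X, Finset.coe_singleton, Set.image_singleton]
  refine congrArg _ (funext fun k => ?_)
  rw [Finsupp.single_eq_pi_single, Pi.single_apply, Pi.single_apply, Nat.cast_ite, Nat.cast_one,
    Nat.cast_zero]

variable [PartialOrder R] [CanonicallyOrderedAdd R]

theorem exponents_add (f g : MvPolynomial ι R) :
    exponents (f + g) = exponents f ∪ exponents g := by
  rw [exponents, exponents, exponents, ← Set.image_union]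
  congr 1
  ext m
  simp only [Finset.mem_coe, MvPolynomial.mem_support_iff, MvPolynomial.coeff_add, Set.mem_union,
    Ne, add_eq_zero, not_and_or]

variable [NoZeroDivisors R]

theorem exponents_mul (f g : MvPolynomial ι R) :
    exponents (f * g) = exponents f + exponents g := by
  classical
  ext x
  simp only [exponents, Set.mem_image, Set.mem_add, Finset.mem_coe, MvPolynomial.mem_support_iff,
    MvPolynomial.coeff_mul]
  constructor
  · rintro ⟨m, hm, rfl⟩
    obtain ⟨⟨p, q⟩, hpq, h⟩ := Finset.exists_ne_zero_of_sum_ne_zero hm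
    refine ⟨_, ⟨p, left_ne_zero_of_mul h, rfl⟩, _, ⟨q, right_ne_zero_of_mul h, rfl⟩, ?_⟩
    obtain rfl : p + q = m := Finset.HasAntidiagonal.mem_antidiagonal.1 hpq
    exact funext fun i => (Nat.cast_add (p i) (q i)).symm
  · rintro ⟨_, ⟨p, hp, rfl⟩, _, ⟨q, hq, rfl⟩, rfl⟩
    refine ⟨p + q, fun h => ?_, funext fun i => Nat.cast_add (p i) (q i)⟩
    exact mul_ne_zero hp hq (Finset.sum_eq_zero_iff.1 h (p, q)
      (Finset.HasAntidiagonal.mem_antidiagonal.2 rfl))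

theorem exponents_prod [Nontrivial R] {κ : Type*} (s : Finset κ) (f : κ → MvPolynomial ι R) :
    exponents (∏ k ∈ s, f k) = ∑ k ∈ s, exponents (f k) := by
  classical
  induction s using Finset.induction_on with
  | empty => rw [Finset.prod_empty, Finset.sum_empty, exponents_one]
  | insert k s hk ih => rw [Finset.prod_insert hk, Finset.sum_insert hk, exponents_mul, ih]

end Exponents

theorem exponents_pellPolynomial (d : ℕ) :
    exponents (pellPolynomial d) =
      ∑ i : Fin d, {0, Pi.single i 1} +
        ∑ j : Fin (d - 1),
          {0, Pi.single ⟨j.val, by omega⟩ 1,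
            Pi.single ⟨j.val, by omega⟩ 1 + Pi.single ⟨j.val + 1, by omega⟩ 1} := by
  have hmap : pellPolynomial d = MvPolynomial.map (Nat.castRingHom ℤ)
      ((∏ i : Fin d, (1 + MvPolynomial.X i)) *
        ∏ j : Fin (d - 1),
          (1 + MvPolynomial.X (⟨j.val, by omega⟩ : Fin d) +
            MvPolynomial.X (⟨j.val, by omega⟩ : Fin d) *
              MvPolynomial.X (⟨j.val + 1, by omega⟩ : Fin d))) := by
    simp only [pellPolynomial, map_mul, map_prod, map_add, map_one, MvPolynomial.map_X]
  rw [hmap, exponents_map_of_injective _ Nat.cast_injective]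
  simp only [exponents_mul, exponents_prod, exponents_add, exponents_one, exponents_X,
    Set.singleton_add_singleton, Set.singleton_union, ← Set.singleton_zero, Set.insert_union]

section SignConditions

/-- `t` lies in every closed half-line at the origin that contains `s`: a linear form taking the
value `s` at `u` and `t` at `w` separates `u` and `w` only weakly, and vanishes at `w` if it
vanishes at `u`. -/
def SignConforms (s t : ℝ) : Prop := (0 ≤ s → 0 ≤ t) ∧ (s ≤ 0 → t ≤ 0)

variable {s t : ℝ}

theorem SignConforms.refl (s : ℝ) : SignConforms s s := ⟨id, id⟩

theorem SignConforms.zero (s : ℝ) : SignConforms s 0 := ⟨fun _ => le_rfl, fun _ => le_rfl⟩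

theorem SignConforms.eq_zero (h : SignConforms s t) (hs : s = 0) : t = 0 :=
  le_antisymm (h.2 hs.le) (h.1 hs.ge)

theorem SignConforms.pos (h : SignConforms s t) (ht : 0 < t) : 0 < s :=
  lt_of_not_ge fun hs => (h.2 hs).not_gt ht

theorem SignConforms.neg (h : SignConforms s t) (ht : t < 0) : s < 0 :=
  lt_of_not_ge fun hs => (h.1 hs).not_gt ht

theorem SignConforms.of_pos (hs : 0 < s) (ht : 0 ≤ t) : SignConforms s t :=
  ⟨fun _ => ht, fun h => absurd h hs.not_ge⟩

theorem SignConforms.of_neg (hs : s < 0) (ht : t ≤ 0) : SignConforms s t :=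
  ⟨fun h => absurd h hs.not_ge, fun _ => ht⟩

theorem SignConforms.eq_zero_of_neg (h : SignConforms s t) (h' : SignConforms s (-t)) : t = 0 := by
  rcases le_total 0 s with hs | hs
  · exact le_antisymm (neg_nonneg.1 (h'.1 hs)) (h.1 hs)
  · exact le_antisymm (h.2 hs) (neg_nonpos.1 (h'.2 hs))

theorem SignConforms.eventually_add_mul {a : ℝ} (h : SignConforms s a) (ha : a ≠ 0) (b : ℝ) :
    ∀ᶠ c : ℝ in Filter.atTop, SignConforms s (b + c * a) := by
  rcases ha.lt_or_gt with ha | ha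
  · filter_upwards [(Filter.tendsto_atBot_add_const_left _ b
      (Filter.tendsto_id.atTop_mul_const_of_neg ha)).eventually_le_atBot 0] with c hc
    exact .of_neg (h.neg ha) hc
  · filter_upwards [(Filter.tendsto_atTop_add_const_left _ b
      (Filter.tendsto_id.atTop_mul_const ha)).eventually_ge_atTop 0] with c hc
    exact .of_pos (h.pos ha) hc

theorem SignConforms.eventually_of_add_mul (s a : ℝ) :
    ∀ᶠ c : ℝ in Filter.atTop, SignConforms (s + c * a) a := by
  rcases lt_trichotomy a 0 with ha | rfl | ha
  · filter_upwards [(Filter.tendsto_atBot_add_const_left _ s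
      (Filter.tendsto_id.atTop_mul_const_of_neg ha)).eventually_lt_atBot 0] with c hc
    exact .of_neg hc ha.le
  · exact .of_forall fun c => .zero _
  · filter_upwards [(Filter.tendsto_atTop_add_const_left _ s
      (Filter.tendsto_id.atTop_mul_const ha)).eventually_gt_atTop 0] with c hc
    exact .of_pos hc ha.le

theorem mem_normalConeAt_pair {n : ℕ} {u w a : Fin n → ℝ} :
    w ∈ normalConeAt {0, a} u ↔ SignConforms (u ⬝ᵥ a) (w ⬝ᵥ a) := by
  simp only [normalConeAt, mem_innerNormalCone, minFace, SignConforms, Set.mem_insert_iff,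
    Set.mem_singleton_iff, Set.mem_ofPred_eq, forall_eq_or_imp, forall_eq, and_imp,
    dotProduct_zero]
  grind

theorem mem_normalConeAt_triangle {n : ℕ} {u w a b : Fin n → ℝ}
    (ha : SignConforms (u ⬝ᵥ a) (w ⬝ᵥ a)) (hb : SignConforms (u ⬝ᵥ b) (w ⬝ᵥ b)) :
    w ∈ normalConeAt {0, a, a + b} u ↔
      (0 < u ⬝ᵥ a → u ⬝ᵥ b < 0 → SignConforms (u ⬝ᵥ a + u ⬝ᵥ b) (w ⬝ᵥ a + w ⬝ᵥ b)) := by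
  simp only [normalConeAt, mem_innerNormalCone, minFace, Set.mem_insert_iff,
    Set.mem_singleton_iff, Set.mem_ofPred_eq, forall_eq_or_imp, forall_eq, and_imp,
    dotProduct_add, dotProduct_zero]
  unfold SignConforms at *
  grind

end SignConditions

section PellytopeCones

variable {d : ℕ} {u v w : Fin d → ℝ}

/-- The inequalities on `w` that cut out the cone of the pellytope fan with `u` in its relative
interior. -/
def PellConforms (u w : Fin d → ℝ) : Prop :=
  (∀ i, SignConforms (u i) (w i)) ∧
    ∀ i j : Fin d, (j : ℕ) = i + 1 → 0 < u i → u j < 0 → SignConforms (u i + u j) (w i + w j)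

theorem normalConeAt_pellytope (u : Fin d → ℝ) :
    normalConeAt (pellytope d) u =
      (⨅ i : Fin d, normalConeAt {0, Pi.single i 1} u) ⊓
        ⨅ j : Fin (d - 1), normalConeAt {0, Pi.single ⟨j.val, by omega⟩ 1,
          Pi.single ⟨j.val, by omega⟩ 1 + Pi.single ⟨j.val + 1, by omega⟩ 1} u := by
  have hconv : pellytope d = convexHull ℝ (exponents (pellPolynomial d)) := rfl
  have hpair (i : Fin d) : (minFace {0, Pi.single i 1} u).Nonempty :=
    minFace_nonempty (Set.toFinite _) (Set.insert_nonempty _ _) u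
  have htriangle (i j : Fin d) :
      (minFace {0, Pi.single i 1, Pi.single i 1 + Pi.single j 1} u).Nonempty :=
    minFace_nonempty (Set.toFinite _) (Set.insert_nonempty _ _) u
  rw [hconv, normalConeAt_convexHull, exponents_pellPolynomial,
    normalConeAt_add (nonempty_minFace_sum fun i _ => hpair i)
      (nonempty_minFace_sum fun j _ => htriangle _ _),
    normalConeAt_sum fun i _ => hpair i, normalConeAt_sum fun j _ => htriangle _ _]
  simp only [Finset.mem_univ, iInf_pos]

theorem mem_normalConeAt_pellytope :
    w ∈ normalConeAt (pellytope d) u ↔ PellConforms u w := by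
  simp only [normalConeAt_pellytope, Submodule.mem_inf, Submodule.mem_iInf,
    mem_normalConeAt_pair, dotProduct_single_one, PellConforms]
  refine and_congr_right fun h => ?_
  have htriangle (i j : Fin d) : w ∈ normalConeAt {0, Pi.single i 1,
      Pi.single i 1 + Pi.single j 1} u ↔
        (0 < u i → u j < 0 → SignConforms (u i + u j) (w i + w j)) := by
    simpa only [dotProduct_single_one] using
      mem_normalConeAt_triangle (u := u) (w := w) (a := Pi.single i 1) (b := Pi.single j 1)
        (by simpa only [dotProduct_single_one] using h i)
        (by simpa only [dotProduct_single_one] using h j)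
  simp only [htriangle]
  refine ⟨?_, fun h j => h _ _ rfl⟩
  rintro h i ⟨_, hj⟩ rfl
  exact h ⟨i, by omega⟩

theorem pellFan_eq_range (d : ℕ) : pellFan d = Set.range (normalConeAt (pellytope d)) :=
  innerNormalFan_eq_range _

theorem pellFan_nonempty (d : ℕ) : (pellFan d).Nonempty :=
  pellFan_eq_range d ▸ Set.range_nonempty _

theorem PellConforms.refl (u : Fin d → ℝ) : PellConforms u u :=
  ⟨fun _ => .refl _, fun _ _ _ _ _ => .refl _⟩

theorem salient_normalConeAt_pellytope (u : Fin d → ℝ) :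
    (normalConeAt (pellytope d) u : ConvexCone ℝ (Fin d → ℝ)).Salient := fun _ hw hw0 hneg =>
  hw0 <| funext fun i => ((mem_normalConeAt_pellytope.1 hw).1 i).eq_zero_of_neg
    ((mem_normalConeAt_pellytope.1 hneg).1 i)

/-- The conditions of `PellConforms u w` on the forms `x_i` and `x_i + x_{i+1}` that vanish at `v`.
They define the image in `ℝ^d / ℝ v` of the cone with `u` in its relative interior, provided that
this cone contains `v`. -/
def PellConformsMod (v u w : Fin d → ℝ) : Prop :=
  (∀ i, v i = 0 → SignConforms (u i) (w i)) ∧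
    ∀ i j : Fin d, (j : ℕ) = i + 1 → v i + v j = 0 → 0 < u i → u j < 0 →
      SignConforms (u i + u j) (w i + w j)

theorem add_smul_apply_add_apply (w v : Fin d → ℝ) (c : ℝ) (i j : Fin d) :
    (w + c • v) i + (w + c • v) j = w i + w j + c * (v i + v j) := by
  simp only [Pi.add_apply, Pi.smul_apply, smul_eq_mul]
  ring

theorem PellConforms.exists_add_smul_iff (huv : PellConforms u v) :
    (∃ c : ℝ, PellConforms u (w + c • v)) ↔ PellConformsMod v u w := by
  constructor
  · rintro ⟨c, h₁, h₂⟩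
    refine ⟨fun i hi => ?_, fun i j hij hv hi hj => ?_⟩
    · simpa [hi] using h₁ i
    · simpa only [add_smul_apply_add_apply, hv, mul_zero, add_zero] using h₂ i j hij hi hj
  · rintro ⟨h₁, h₂⟩
    refine Filter.Eventually.exists (f := Filter.atTop) (Filter.Eventually.and ?_ ?_)
    · refine Filter.eventually_all.2 fun i => ?_
      by_cases hi : v i = 0
      · exact .of_forall fun c => by simpa [hi] using h₁ i hi
      · exact (huv.1 i).eventually_add_mul hi (w i)
    · simp only [Filter.eventually_all, add_smul_apply_add_apply]
      intro i j hij hi hj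
      by_cases hv : v i + v j = 0
      · exact .of_forall fun c => by simpa [hv] using h₂ i j hij hv hi hj
      · exact (huv.2 i j hij hi hj).eventually_add_mul hv _

theorem exists_add_smul_pellConforms (u v : Fin d → ℝ) : ∃ c : ℝ, PellConforms (u + c • v) v := by
  refine Filter.Eventually.exists (f := Filter.atTop) (Filter.Eventually.and ?_ ?_)
  · exact Filter.eventually_all.2 fun i => SignConforms.eventually_of_add_mul (u i) (v i)
  · simp only [Filter.eventually_all, add_smul_apply_add_apply]
    intro i j _
    exact (SignConforms.eventually_of_add_mul _ _).mono fun c hc _ _ => hc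

theorem mem_map_normalConeAt_pellytope {W : Type*} [AddCommGroup W] [Module ℝ W]
    {f : (Fin d → ℝ) →ₗ[ℝ] W} (hker : LinearMap.ker f = Submodule.span ℝ {v})
    (huv : PellConforms u v) :
    f w ∈ PointedCone.map f (normalConeAt (pellytope d) u) ↔ PellConformsMod v u w := by
  rw [← huv.exists_add_smul_iff, PointedCone.mem_map]
  constructor
  · rintro ⟨w', hw', hww'⟩
    have hmem : w' - w ∈ Submodule.span ℝ {v} := by
      rw [← hker, LinearMap.mem_ker, map_sub, hww', sub_self]
    obtain ⟨c, hc⟩ := Submodule.mem_span_singleton.1 hmem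
    exact ⟨c, by rwa [hc, add_sub_cancel, ← mem_normalConeAt_pellytope]⟩
  · rintro ⟨c, hc⟩
    have hfv : f v = 0 := hker.ge (Submodule.mem_span_singleton_self v)
    exact ⟨w + c • v, mem_normalConeAt_pellytope.2 hc, by
      rw [map_add, map_smul, hfv, smul_zero, add_zero]⟩

theorem isStarVia_pellFan {W : Type*} [AddCommGroup W] [Module ℝ W] {f : (Fin d → ℝ) →ₗ[ℝ] W}
    (hf : Function.Surjective f) (hker : LinearMap.ker f = Submodule.span ℝ {v})
    {c : W → PointedCone ℝ W}
    (hc : ∀ u w, PellConforms u v → (f w ∈ c (f u) ↔ PellConformsMod v u w)) :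
    IsStarVia (pellFan d) v f (Set.range c) := by
  have hmap (u : Fin d → ℝ) (hu : PellConforms u v) :
      PointedCone.map f (normalConeAt (pellytope d) u) = c (f u) :=
    SetLike.ext <| hf.forall.2 fun w =>
      (mem_map_normalConeAt_pellytope hker hu).trans (hc u w hu).symm
  convert isStarVia_of_surjective (pellFan d) hf hker using 1
  rw [pellFan_eq_range]
  refine Set.Subset.antisymm ?_ ?_
  · rintro _ ⟨y, rfl⟩
    obtain ⟨u, rfl⟩ := hf y
    obtain ⟨t, ht⟩ := exists_add_smul_pellConforms u v
    have hfv : f v = 0 := hker.ge (Submodule.mem_span_singleton_self v)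
    refine ⟨_, ⟨⟨u + t • v, rfl⟩, mem_normalConeAt_pellytope.2 ht⟩, ?_⟩
    rw [hmap _ ht, map_add, map_smul, hfv, smul_zero, add_zero]
  · rintro _ ⟨_, ⟨⟨u, rfl⟩, hv⟩, rfl⟩
    exact ⟨f u, (hmap u (mem_normalConeAt_pellytope.1 hv)).symm⟩

end PellytopeCones

section Coordinates

variable {d a b : ℕ}

theorem stdVec_succ (i : Fin d) : stdVec d (i + 1) = Pi.single i 1 := by
  ext k
  simp [stdVec, Pi.single_apply, Fin.ext_iff]

/-- Forgetting the coordinate `x_a`, where the coordinates are counted from `0`. -/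
def dropCoord (h : a + 1 + b = d) : (Fin d → ℝ) →ₗ[ℝ] (Fin a → ℝ) × (Fin b → ℝ) :=
  (LinearMap.funLeft ℝ ℝ fun k : Fin a => (⟨k.val, by omega⟩ : Fin d)).prod
    (LinearMap.funLeft ℝ ℝ fun k : Fin b => (⟨a + 1 + k.val, by omega⟩ : Fin d))

theorem dropCoord_surjective (h : a + 1 + b = d) : Function.Surjective (dropCoord h) := by
  subst h
  rintro ⟨y, z⟩
  refine ⟨Fin.append (Fin.snoc (α := fun _ => ℝ) y 0) z, Prod.ext ?_ ?_⟩
  · ext k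
    exact (Fin.append_left _ z k.castSucc).trans (Fin.snoc_castSucc (α := fun _ => ℝ) 0 y k)
  · ext k
    exact Fin.append_right _ z k

theorem dropCoord_single (h : a + 1 + b = d) :
    dropCoord h (Pi.single ⟨a, by omega⟩ 1) = 0 := by
  refine Prod.ext (funext fun k => ?_) (funext fun k => ?_)
  · exact Pi.single_eq_of_ne (Fin.ne_of_val_ne (by lia)) 1
  · exact Pi.single_eq_of_ne (Fin.ne_of_val_ne (by lia)) 1

theorem pellConforms_comp_iff {n s : ℕ} (g : Fin n → Fin d) (hg : ∀ k, (g k : ℕ) = s + k)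
    (u w : Fin d → ℝ) :
    PellConforms (u ∘ g) (w ∘ g) ↔
      (∀ i : Fin d, s ≤ i → i < s + n → SignConforms (u i) (w i)) ∧
        ∀ i j : Fin d, (j : ℕ) = i + 1 → s ≤ i → j < s + n → 0 < u i → u j < 0 →
          SignConforms (u i + u j) (w i + w j) := by
  have hsurj (i : Fin d) (hi : s ≤ i) (hin : i < s + n) : ∃ k, g k = i :=
    ⟨⟨i - s, by omega⟩, Fin.ext ((hg _).trans (Nat.add_sub_cancel' hi))⟩
  constructor
  · refine fun h => ⟨fun i hi hin => ?_, fun i j hij hi hjn => ?_⟩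
    · obtain ⟨k, rfl⟩ := hsurj i hi hin
      exact h.1 k
    · obtain ⟨k, rfl⟩ := hsurj i hi (by omega)
      obtain ⟨l, rfl⟩ := hsurj j (by omega) hjn
      rw [hg, hg] at hij
      exact h.2 k l (by omega)
  · refine fun h => ⟨fun k => ?_, fun k l hkl => ?_⟩
    · exact h.1 (g k) (by rw [hg]; omega) (by rw [hg]; omega)
    · exact h.2 (g k) (g l) (by rw [hg, hg]; omega) (by rw [hg]; omega) (by rw [hg]; omega)

theorem pellConformsMod_iff_dropCoord (h : a + 1 + b = d) {u w : Fin d → ℝ} :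
    PellConformsMod (Pi.single ⟨a, by omega⟩ 1) u w ↔
      PellConforms (dropCoord h u).1 (dropCoord h w).1 ∧
        PellConforms (dropCoord h u).2 (dropCoord h w).2 := by
  have hzero (i : Fin d) : (Pi.single ⟨a, by omega⟩ 1 : Fin d → ℝ) i = 0 ↔ (i : ℕ) ≠ a := by
    grind
  have hzero_add (i j : Fin d) :
      (Pi.single ⟨a, by omega⟩ 1 : Fin d → ℝ) i + (Pi.single ⟨a, by omega⟩ 1 : Fin d → ℝ) j = 0 ↔
        (i : ℕ) ≠ a ∧ (j : ℕ) ≠ a := by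
    grind
  have hleft := pellConforms_comp_iff (d := d) (fun k : Fin a => ⟨k.val, by omega⟩)
    (fun k => (zero_add k.val).symm) u w
  have hright := pellConforms_comp_iff (fun k : Fin b => ⟨a + 1 + k.val, by omega⟩)
    (fun k => rfl) u w
  refine Iff.trans ?_ (and_congr hleft hright).symm
  simp only [PellConformsMod, hzero, hzero_add]
  grind

theorem pellConformsMod_neg_iff {u v w : Fin d → ℝ} :
    PellConformsMod (-v) u w ↔ PellConformsMod v u w := by
  simp only [PellConformsMod, Pi.neg_apply, neg_eq_zero, ← neg_add]

theorem isStarVia_pellFan_single (h : a + 1 + b = d) {v : Fin d → ℝ}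
    (hv : v = stdVec d (a + 1) ∨ v = -stdVec d (a + 1)) :
    IsStarVia (pellFan d) v (dropCoord h) (fanProd (pellFan a) (pellFan b)) := by
  have hmod (u w : Fin d → ℝ) : PellConformsMod v u w ↔
      PellConforms (dropCoord h u).1 (dropCoord h w).1 ∧
        PellConforms (dropCoord h u).2 (dropCoord h w).2 := by
    rw [← pellConformsMod_iff_dropCoord, ← stdVec_succ]
    rcases hv with rfl | rfl
    · rfl
    · exact pellConformsMod_neg_iff
  have hker : LinearMap.ker (dropCoord h) = Submodule.span ℝ {v} := by
    rw [ker_eq_span_singleton_of_finrank_eq_succ (dropCoord_surjective h) (by simp; omega)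
      (by simp) (dropCoord_single h), ← stdVec_succ]
    rcases hv with rfl | rfl
    · rfl
    · rw [← Set.neg_singleton, Submodule.span_neg]
  rw [pellFan_eq_range a, pellFan_eq_range b, fanProd_range]
  refine isStarVia_pellFan (dropCoord_surjective h) hker fun u w _ => ?_
  rw [hmod]
  exact and_congr mem_normalConeAt_pellytope mem_normalConeAt_pellytope

/-- Replacing the coordinates `x_a` and `x_{a+1}` by their sum, where the coordinates are counted
from `0`. -/
def sumCoord (h : a + 2 + b = d) : (Fin d → ℝ) →ₗ[ℝ] (Fin a → ℝ) × (Fin 1 → ℝ) × (Fin b → ℝ) :=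
  (LinearMap.funLeft ℝ ℝ fun k : Fin a => (⟨k.val, by omega⟩ : Fin d)).prod
    ((LinearMap.funLeft ℝ ℝ (fun _ : Fin 1 => (⟨a, by omega⟩ : Fin d)) +
      LinearMap.funLeft ℝ ℝ (fun _ : Fin 1 => (⟨a + 1, by omega⟩ : Fin d))).prod
      (LinearMap.funLeft ℝ ℝ fun k : Fin b => (⟨a + 2 + k.val, by omega⟩ : Fin d)))

theorem sumCoord_surjective (h : a + 2 + b = d) : Function.Surjective (sumCoord h) := by
  subst h
  rintro ⟨x, y, z⟩
  let t : Fin (a + 1 + 1) → ℝ :=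
    Fin.snoc (α := fun _ => ℝ) (Fin.snoc (α := fun _ => ℝ) x (y 0)) 0
  refine ⟨Fin.append t z, Prod.ext (funext fun k => ?_)
    (Prod.ext (funext <| Fin.forall_fin_one.2 ?_) (funext fun k => Fin.append_right t z k))⟩
  · refine (Fin.append_left t z k.castSucc.castSucc).trans ?_
    simp only [t, Fin.snoc_castSucc]
  · refine (congrArg₂ (· + ·) (Fin.append_left t z (Fin.last a).castSucc)
      (Fin.append_left t z (Fin.last (a + 1)))).trans ?_
    simp only [t, Fin.snoc_castSucc, Fin.snoc_last, add_zero]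

theorem sumCoord_single_sub_single (h : a + 2 + b = d) :
    sumCoord h (Pi.single ⟨a, by omega⟩ 1 - Pi.single ⟨a + 1, by omega⟩ 1) = 0 := by
  refine Prod.ext ?_ (Prod.ext ?_ ?_) <;> ext k <;> simp [sumCoord] <;> grind

theorem pellConforms_fin_one_iff {u w : Fin 1 → ℝ} :
    PellConforms u w ↔ SignConforms (u 0) (w 0) := by
  simp [PellConforms, Fin.forall_fin_one]

theorem pellConformsMod_single_sub_single_iff {p q : Fin d} (hpq : (q : ℕ) = p + 1)
    {u w : Fin d → ℝ} (hp : 0 < u p) (hq : u q < 0) :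
    PellConformsMod (Pi.single p 1 - Pi.single q 1) u w ↔
      (∀ i, i ≠ p → i ≠ q → SignConforms (u i) (w i)) ∧
        SignConforms (u p + u q) (w p + w q) ∧
          ∀ i j : Fin d, (j : ℕ) = i + 1 → i ≠ p → i ≠ q → j ≠ p → 0 < u i → u j < 0 →
            SignConforms (u i + u j) (w i + w j) := by
  have hzero (i : Fin d) :
      (Pi.single p 1 - Pi.single q 1 : Fin d → ℝ) i = 0 ↔ i ≠ p ∧ i ≠ q := by
    grind [Pi.sub_apply]
  have hzero_add (i j : Fin d) (hij : (j : ℕ) = i + 1) :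
      (Pi.single p 1 - Pi.single q 1 : Fin d → ℝ) i +
          (Pi.single p 1 - Pi.single q 1 : Fin d → ℝ) j = 0 ↔
        i = p ∧ j = q ∨ i ≠ p ∧ i ≠ q ∧ j ≠ p := by
    grind [Pi.sub_apply]
  simp only [PellConformsMod, hzero]
  grind

theorem pellConformsMod_iff_sumCoord (h : a + 2 + b = d) {u w : Fin d → ℝ}
    (hpos : 0 < u ⟨a, by omega⟩) (hneg : u ⟨a + 1, by omega⟩ < 0) :
    PellConformsMod (Pi.single ⟨a, by omega⟩ 1 - Pi.single ⟨a + 1, by omega⟩ 1) u w ↔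
      PellConforms (sumCoord h u).1 (sumCoord h w).1 ∧
        PellConforms (sumCoord h u).2.1 (sumCoord h w).2.1 ∧
          PellConforms (sumCoord h u).2.2 (sumCoord h w).2.2 := by
  have hleft := pellConforms_comp_iff (d := d) (fun k : Fin a => ⟨k.val, by omega⟩)
    (fun k => (zero_add k.val).symm) u w
  have hright := pellConforms_comp_iff (fun k : Fin b => ⟨a + 2 + k.val, by omega⟩)
    (fun k => rfl) u w
  refine Iff.trans ?_ (and_congr hleft (and_congr pellConforms_fin_one_iff hright)).symm
  have hsum (x : Fin d → ℝ) :
      (sumCoord h x).2.1 0 = x ⟨a, by omega⟩ + x ⟨a + 1, by omega⟩ := rfl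
  rw [pellConformsMod_single_sub_single_iff rfl hpos hneg, hsum, hsum]
  simp only [ne_eq, Fin.ext_iff]
  grind

theorem isStarVia_pellFan_single_sub_single (h : a + 2 + b = d) :
    IsStarVia (pellFan d) (stdVec d (a + 1) - stdVec d (a + 2)) (sumCoord h)
      (fanProd (pellFan a) (fanProd (pellFan 1) (pellFan b))) := by
  rw [show stdVec d (a + 1) - stdVec d (a + 2) =
      Pi.single ⟨a, by omega⟩ 1 - Pi.single ⟨a + 1, by omega⟩ 1 from
    congrArg₂ (· - ·) (stdVec_succ ⟨a, by omega⟩) (stdVec_succ ⟨a + 1, by omega⟩)]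
  rw [pellFan_eq_range a, pellFan_eq_range 1, pellFan_eq_range b, fanProd_range, fanProd_range]
  have hker := ker_eq_span_singleton_of_finrank_eq_succ (sumCoord_surjective h)
    (by simp; omega) (Function.ne_iff.2 ⟨⟨a, by omega⟩, by simp [Fin.ext_iff]⟩)
    (sumCoord_single_sub_single h)
  refine isStarVia_pellFan (sumCoord_surjective h) hker fun u w huv => ?_
  have hpos : 0 < u ⟨a, by omega⟩ := (huv.1 _).pos (by simp)
  have hneg : u ⟨a + 1, by omega⟩ < 0 := (huv.1 _).neg (by simp)
  rw [pellConformsMod_iff_sumCoord h hpos hneg]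
  exact and_congr mem_normalConeAt_pellytope
    (and_congr mem_normalConeAt_pellytope mem_normalConeAt_pellytope)

end Coordinates

section Rays

variable {d : ℕ} {u v w : Fin d → ℝ}

theorem mem_pellGenerators :
    v ∈ pellGenerators d ↔ (∃ i : Fin d, v = Pi.single i 1 ∨ v = -Pi.single i 1) ∨
      ∃ i j : Fin d, (j : ℕ) = i + 1 ∧ v = Pi.single i 1 - Pi.single j 1 := by
  constructor
  · rintro (⟨i, hi, hid, hv⟩ | ⟨i, hi, hid, hv⟩) <;> obtain ⟨i, rfl⟩ := Nat.exists_eq_add_of_le' hi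
    · exact .inl ⟨⟨i, hid⟩, by rwa [← stdVec_succ]⟩
    · exact .inr ⟨⟨i, by omega⟩, ⟨i + 1, hid⟩, rfl, by rwa [← stdVec_succ, ← stdVec_succ]⟩
  · rintro (⟨i, hv⟩ | ⟨i, j, hij, hv⟩)
    · exact .inl ⟨i + 1, by omega, i.2, by rwa [stdVec_succ]⟩
    · refine .inr ⟨i + 1, by omega, by omega, ?_⟩
      rwa [stdVec_succ, ← hij, stdVec_succ]

theorem ne_zero_of_mem_pellGenerators (hv : v ∈ pellGenerators d) : v ≠ 0 := by
  rw [Function.ne_iff]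
  rcases mem_pellGenerators.1 hv with ⟨i, rfl | rfl⟩ | ⟨i, j, hij, rfl⟩
  · exact ⟨i, by simp⟩
  · exact ⟨i, by simp⟩
  · have hne : i ≠ j := by lia
    exact ⟨i, by simp [hne]⟩

theorem exists_mem_pellGenerators_pellConforms (hu : u ≠ 0) :
    ∃ v ∈ pellGenerators d, PellConforms u v := by
  by_cases! h : ∃ i j : Fin d, (j : ℕ) = i + 1 ∧ 0 < u i ∧ u j < 0
  · obtain ⟨i, j, hij, hi, hj⟩ := h
    refine ⟨_, mem_pellGenerators.2 (.inr ⟨i, j, hij, rfl⟩), ?_, ?_⟩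
    · grind [SignConforms, Pi.sub_apply]
    · grind [SignConforms, Pi.sub_apply]
  · obtain ⟨i, hi⟩ : ∃ i, u i ≠ 0 := Function.ne_iff.1 hu
    have hvacuous (w : Fin d → ℝ) (hw : ∀ k, SignConforms (u k) (w k)) : PellConforms u w :=
      ⟨hw, fun k l hkl hk hl => absurd hl (h k l hkl hk).not_gt⟩
    rcases hi.lt_or_gt with hi | hi
    · refine ⟨_, mem_pellGenerators.2 (.inl ⟨i, .inr rfl⟩), hvacuous _ fun k => ?_⟩
      grind [SignConforms, Pi.neg_apply]
    · refine ⟨_, mem_pellGenerators.2 (.inl ⟨i, .inl rfl⟩), hvacuous _ fun k => ?_⟩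
      grind [SignConforms]

theorem mem_ray_of_pellConforms (hv : v ∈ pellGenerators d) (h : PellConforms v w) : w ∈ ray v := by
  rw [mem_ray]
  rcases mem_pellGenerators.1 hv with ⟨i, rfl | rfl⟩ | ⟨i, j, hij, rfl⟩
  · refine ⟨w i, (h.1 i).1 (by simp), ?_⟩
    ext k
    have := (h.1 k).eq_zero
    grind [Pi.smul_apply, smul_eq_mul]
  · refine ⟨-w i, neg_nonneg.2 ((h.1 i).2 (by simp)), ?_⟩
    ext k
    have := (h.1 k).eq_zero
    grind [Pi.smul_apply, smul_eq_mul, Pi.neg_apply]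
  · have hne : i ≠ j := by lia
    have hsum : w i + w j = 0 := (h.2 i j hij (by simp [hne]) (by simp [hne.symm])).eq_zero
      (by simp [hne, hne.symm])
    refine ⟨w i, (h.1 i).1 (by simp [hne]), ?_⟩
    ext k
    have := (h.1 k).eq_zero
    grind [Pi.smul_apply, smul_eq_mul, Pi.sub_apply]

theorem normalConeAt_pellytope_of_mem_pellGenerators (hv : v ∈ pellGenerators d) :
    normalConeAt (pellytope d) v = ray v :=
  le_antisymm (fun _ hw => mem_ray_of_pellConforms hv (mem_normalConeAt_pellytope.1 hw))
    (ray_le_iff.2 (mem_normalConeAt_pellytope.2 (.refl v)))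

theorem fanRays_pellFan (d : ℕ) : fanRays (pellFan d) = ray '' pellGenerators d := by
  rw [pellFan_eq_range]
  refine Set.Subset.antisymm ?_ ?_
  · rintro _ ⟨⟨u, rfl⟩, hrank⟩
    have hu : u ≠ 0 := by
      rintro rfl
      have hbot : linSpan (normalConeAt (pellytope d) 0) = ⊥ :=
        Submodule.span_eq_bot.2 fun w hw => funext fun i =>
          ((mem_normalConeAt_pellytope.1 hw).1 i).eq_zero rfl
      rw [hbot, finrank_bot] at hrank
      exact zero_ne_one hrank
    obtain ⟨v, hv, huv⟩ := exists_mem_pellGenerators_pellConforms hu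
    exact ⟨v, hv, (eq_ray_of_finrank_linSpan_eq_one (salient_normalConeAt_pellytope u) hrank
      (mem_normalConeAt_pellytope.2 huv) (ne_zero_of_mem_pellGenerators hv)).symm⟩
  · rintro _ ⟨v, hv, rfl⟩
    refine ⟨⟨v, normalConeAt_pellytope_of_mem_pellGenerators hv⟩, ?_⟩
    rw [linSpan_ray, finrank_span_singleton (ne_zero_of_mem_pellGenerators hv)]

end Rays

theorem mainTheorem7 (d : ℕ) (hd : 1 ≤ d) :
    -- the rays of the fan
    (fanRays (pellFan d) = ray '' pellGenerators d) ∧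
    -- the rays of `e_1` and `-e_1`
    (∀ v : Fin d → ℝ, (v = stdVec d 1 ∨ v = -stdVec d 1) →
      ∃ φ : ((Fin d → ℝ) ⧸ linSpan (ray v)) ≃ₗ[ℝ] (Fin (d - 1) → ℝ),
        (∀ x : Fin d → ℝ, φ ((linSpan (ray v)).mkQ x) =
          fun k => x ⟨k.val + 1, by omega⟩) ∧
        IsFanIso φ (fanStar (pellFan d) (ray v)) (pellFan (d - 1))) ∧
    -- the rays of `e_d` and `-e_d`
    (∀ v : Fin d → ℝ, (v = stdVec d d ∨ v = -stdVec d d) →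
      ∃ φ : ((Fin d → ℝ) ⧸ linSpan (ray v)) ≃ₗ[ℝ] (Fin (d - 1) → ℝ),
        (∀ x : Fin d → ℝ, φ ((linSpan (ray v)).mkQ x) =
          fun k => x ⟨k.val, by omega⟩) ∧
        IsFanIso φ (fanStar (pellFan d) (ray v)) (pellFan (d - 1))) ∧
    -- the rays of `e_i` and `-e_i` for `1 < i < d`
    (∀ i : ℕ, ∀ _ : 1 < i, ∀ _ : i < d,
      ∀ v : Fin d → ℝ, (v = stdVec d i ∨ v = -stdVec d i) →
      ∃ φ : ((Fin d → ℝ) ⧸ linSpan (ray v)) ≃ₗ[ℝ] (Fin (i - 1) → ℝ) × (Fin (d - i) → ℝ),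
        (∀ x : Fin d → ℝ, φ ((linSpan (ray v)).mkQ x) =
          (fun k => x ⟨k.val, by omega⟩, fun k => x ⟨i + k.val, by omega⟩)) ∧
        IsFanIso φ (fanStar (pellFan d) (ray v))
          (fanProd (pellFan (i - 1)) (pellFan (d - i)))) ∧
    -- the ray of `e_1 - e_2`
    (∀ _ : 2 ≤ d, ∀ v : Fin d → ℝ, v = stdVec d 1 - stdVec d 2 →
      ∃ φ : ((Fin d → ℝ) ⧸ linSpan (ray v)) ≃ₗ[ℝ] (Fin (d - 2) → ℝ) × (Fin 1 → ℝ),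
        (∀ x : Fin d → ℝ, φ ((linSpan (ray v)).mkQ x) =
          (fun k => x ⟨k.val + 2, by omega⟩,
            fun _ => x ⟨0, by omega⟩ + x ⟨1, by omega⟩)) ∧
        IsFanIso φ (fanStar (pellFan d) (ray v))
          (fanProd (pellFan (d - 2)) (pellFan 1))) ∧
    -- the ray of `e_{d-1} - e_d`
    (∀ _ : 2 ≤ d, ∀ v : Fin d → ℝ, v = stdVec d (d - 1) - stdVec d d →
      ∃ φ : ((Fin d → ℝ) ⧸ linSpan (ray v)) ≃ₗ[ℝ] (Fin (d - 2) → ℝ) × (Fin 1 → ℝ),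
        (∀ x : Fin d → ℝ, φ ((linSpan (ray v)).mkQ x) =
          (fun k => x ⟨k.val, by omega⟩,
            fun _ => x ⟨d - 2, by omega⟩ + x ⟨d - 1, by omega⟩)) ∧
        IsFanIso φ (fanStar (pellFan d) (ray v))
          (fanProd (pellFan (d - 2)) (pellFan 1))) ∧
    -- the rays of `e_i - e_{i+1}` for `2 ≤ i ≤ d - 2`
    (∀ i : ℕ, ∀ _ : 2 ≤ i, ∀ _ : i + 2 ≤ d,
      ∀ v : Fin d → ℝ, v = stdVec d i - stdVec d (i + 1) →
      ∃ φ : ((Fin d → ℝ) ⧸ linSpan (ray v)) ≃ₗ[ℝ]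
          (Fin (i - 1) → ℝ) × (Fin 1 → ℝ) × (Fin (d - i - 1) → ℝ),
        (∀ x : Fin d → ℝ, φ ((linSpan (ray v)).mkQ x) =
          (fun k => x ⟨k.val, by omega⟩,
            fun _ => x ⟨i - 1, by omega⟩ + x ⟨i, by omega⟩,
            fun k => x ⟨i + 1 + k.val, by omega⟩)) ∧
        IsFanIso φ (fanStar (pellFan d) (ray v))
          (fanProd (pellFan (i - 1)) (fanProd (pellFan 1) (pellFan (d - i - 1))))) := by
  refine ⟨fanRays_pellFan d, fun v hv => ?_, fun v hv => ?_, fun i hi hid v hv => ?_,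
    fun h2 v hv => ?_, fun h2 v hv => ?_, fun i hi hid v hv => ?_⟩
  · refine ((isStarVia_pellFan_single (a := 0) (b := d - 1) (by omega) hv).trans
      (isFanIso_uniqueProd (pellFan_nonempty 0) _)).congr fun x => ?_
    exact funext fun k => congrArg x (Fin.ext (add_comm (0 + 1) k.val))
  · obtain ⟨a, rfl⟩ := Nat.exists_eq_add_of_le' hd
    exact (isStarVia_pellFan_single (a := a) (b := 0) rfl hv).trans
      (isFanIso_prodUnique _ (pellFan_nonempty 0))
  · obtain ⟨a, rfl⟩ := Nat.exists_eq_add_of_le' hi.le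
    exact isStarVia_pellFan_single (by omega) hv
  · subst hv
    refine ((isStarVia_pellFan_single_sub_single (a := 0) (b := d - 2) (by omega)).trans
      ((isFanIso_uniqueProd (pellFan_nonempty 0) _).trans (isFanIso_prodComm _ _))).congr
      fun x => ?_
    exact Prod.ext (funext fun k => congrArg x (Fin.ext (add_comm (0 + 2) k.val))) rfl
  · obtain ⟨a, rfl⟩ := Nat.exists_eq_add_of_le' h2
    subst hv
    exact (isStarVia_pellFan_single_sub_single (a := a) (b := 0) rfl).trans
      ((IsFanIso.refl _).prodCongr (isFanIso_prodUnique _ (pellFan_nonempty 0)))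
  · obtain ⟨a, rfl⟩ := Nat.exists_eq_add_of_le' (one_le_two.trans hi)
    subst hv
    exact isStarVia_pellFan_single_sub_single (by omega)
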